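/- An inversion sequence of length $n\ge 0$ is an integer sequence $(a_1,\dots,a_n)$ with $0\le a_i<i$ for all $i$. It contains a pattern $\sigma=\sigma_1\sigma_2\sigma_3$ if for some $i<j<k$ the entries $a_i,a_j,a_k$ are in the same relative order (equalities included) as $\sigma_1,\sigma_2,\sigma_3$; otherwise it avoids $\sigma$. Let $\mathcal I_n(-,\neq,\geq)$ be the set of inversion sequences of length $n$ for which there are no $i<j<k$ with $a_j\neq a_k$ and $a_i\geq a_k$. **Theorem.** For every $n$, $\mathcal I_n(-,\neq,\geq)$ is the set of inversion sequences of length $n$ that avoid all of the patterns $010,101,110,120,201,210$. Let $A(z)=\sum_{n\ge 0}|\mathcal I_n(-,\neq,\geq)|\,z^n$, and let $K$ be a field of characteristic $0$ (for instance $\mathbb Q$ or $\mathbb C$). There is exactly one formal power series $X=X(z)\in K[[z]]$ with $$1-X-zX+2zX^2+z^2X-z^2X^3=0,$$ and, in the field $K((z))$ of formal Laurent series, $$A(z)=\frac{(X-1)(1-zX+z^2X)}{zX}.$$ Moreover $$A(z)=1+z+2z^2+5z^3+15z^4+50z^5+178z^6+663z^7+2552z^8+\cdots,$$ and $A(z)$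 is algebraic of degree $3$ over $K(z)$: up to the sign that makes it monic, its minimal polynomial over $K(z)$, in the indeterminate $T$, is $$1-(4-z)T+2(2-z)T^2-T^3.$$ -/

import Mathlib

-- makes the field `K((z))` of formal Laurent series an algebra over `K(z)` in the canonical way
open scoped RatFunc

/-- The inversion sequences of length `n`. The one-based condition `0 ≤ a_i < i` for
`1 ≤ i ≤ n` reads `a i ≤ i` for the zero-based positions `i : Fin n`. -/
def inversionSequences (n : ℕ) : Set (Fin n → ℕ) :=
  {a | ∀ i : Fin n, a i < (i : ℕ) + 1}

/-- There are finitely many inversion sequences of each length, so that `Set.ncard` really counts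
the elements of any subset of `inversionSequences n`. -/
theorem inversionSequences_finite (n : ℕ) : (inversionSequences n).Finite :=
  (Set.finite_Iic (fun i : Fin n => (i : ℕ))).subset
    (fun _ ha i => Nat.le_of_lt_succ (ha i))

/-- The reduction (standardisation) of a finite sequence of natural numbers: its smallest entries
are replaced by `0`, the next-smallest ones by `1`, and so on; that is, each entry is replaced by
the number of distinct values of the sequence that are smaller than it. -/
def reduction {k : ℕ} (w : Fin k → ℕ) : Fin k → ℕ :=
  fun i => ((Finset.univ.image w).filter (fun v => v < w i)).card

/-- `a` contains the pattern `σ`: some (not necessarily consecutive) subsequence of `a` has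
reduction `σ`. -/
def ContainsPattern {n k : ℕ} (a : Fin n → ℕ) (σ : Fin k → ℕ) : Prop :=
  ∃ p : Fin k → Fin n, StrictMono p ∧ reduction (fun i => a (p i)) = σ

/-- `𝓘ₙ(S)`: the inversion sequences of length `n` that avoid all patterns in `S`. -/
def patternAvoiders {k : ℕ} (S : Set (Fin k → ℕ)) (n : ℕ) : Set (Fin n → ℕ) :=
  {a | a ∈ inversionSequences n ∧ ∀ σ ∈ S, ¬ ContainsPattern a σ}

/-- `𝓘ₙ(ρ₁, ρ₂, ρ₃)`: the inversion sequences `a` of length `n` such that there are no positions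
`i < j < k` with `a_i ρ₁ a_j`, `a_j ρ₂ a_k` and `a_i ρ₃ a_k`. -/
def relationAvoiders (ρ₁ ρ₂ ρ₃ : ℕ → ℕ → Prop) (n : ℕ) : Set (Fin n → ℕ) :=
  {a | a ∈ inversionSequences n ∧
    ¬ ∃ i j k : Fin n, i < j ∧ j < k ∧ ρ₁ (a i) (a j) ∧ ρ₂ (a j) (a k) ∧ ρ₃ (a i) (a k)}

/-- The relation `-`, which holds between any two numbers. -/
def noRestriction : ℕ → ℕ → Prop := fun _ _ => True

/-- `𝓘ₙ(-, ≠, ≥)`. -/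
def class663A (n : ℕ) : Set (Fin n → ℕ) :=
  relationAvoiders noRestriction (fun x y => x ≠ y) (fun x y => x ≥ y) n

/-- The patterns 010, 101, 110, 120, 201, 210. -/
def patterns663A : Set (Fin 3 → ℕ) :=
  {![0, 1, 0], ![1, 0, 1], ![1, 1, 0], ![1, 2, 0], ![2, 0, 1], ![2, 1, 0]}

/-- The ordinary generating function `∑ₙ |𝓘ₙ(-, ≠, ≥)| zⁿ`, over a coefficient ring `K`. -/
noncomputable def genFun663A (K : Type*) [Semiring K] : PowerSeries K :=
  PowerSeries.mk (fun n => ((class663A n).ncard : K))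

/-- The kernel `1 - x - z x + 2 z x² + z² x - z² x³`, evaluated at a power series `x` in `z`. -/
noncomputable def kernel663A {K : Type*} [CommRing K] (x : PowerSeries K) : PowerSeries K :=
  let z : PowerSeries K := PowerSeries.X
  1 - x - z * x + 2 * z * x ^ 2 + z ^ 2 * x - z ^ 2 * x ^ 3

/-- The polynomial `1 - (4 - z) A + 2 (2 - z) A² - A³` in the indeterminate `A` over the field
`K(z)` of rational functions. -/
noncomputable def cubic663A (K : Type*) [Field K] : Polynomial (RatFunc K) :=
  let z : RatFunc K := RatFunc.X
  let A : Polynomial (RatFunc K) := Polynomial.X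
  1 - Polynomial.C (4 - z) * A + Polynomial.C (2 * (2 - z)) * A ^ 2 - A ^ 3

/-- The same generating function, regarded as a formal Laurent series in `z`. -/
noncomputable def genFunLaurent663A (K : Type*) [Semiring K] : LaurentSeries K :=
  (genFun663A K : LaurentSeries K)

/-!
Appending an entry to a sequence in the class turns the class into a generating tree. If `p + 1` is
the number of admissible new entries above all old ones, and `k` the number of the other admissible
entries, the label `(p, k)` has the children `(p + 1, 1)`, taken `k` times, and
`(p, 1), (p - 1, 2), …, (0, p + 1)`; the empty sequence has label `(0, 0)`. The generating functions
`F p k` of the subtrees satisfy `F p k = 1 + z · (sum of F over the children of (p, k))`, and this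
system determines every coefficient. It makes `F p k` affine in `k`, and reduces it to a linear
recurrence of order three in `p`, with characteristic polynomial
`z s³ - (1 + z - z²) s² + 2 s - 1`; its roots `s` are the `1 / (z t)` for the roots `t` of the
kernel. Dividing out the one such root with a pole at `z = 0` leaves a recurrence of order two,
whose solution gives `A = F 0 0 = (1 - z t) / (1 - z t - z)`.

Eliminating `t` yields the cubic for `A`. Being monic with constant term `-1` over `K[z]`, it could
only have a unit of `K[z]`, that is a constant, as a root, and comparing `z = 0` with `z = 1`
excludes this; hence it is irreducible.
-/

/-! ### Relative order and reduction -/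

theorem card_image_le_of_factorsThrough {ι α β : Type*} [DecidableEq α] [DecidableEq β]
    (s : Finset ι) {u : ι → α} {w : ι → β} (h : u.FactorsThrough w) :
    (s.image u).card ≤ (s.image w).card := by
  rcases isEmpty_or_nonempty α with hα | hα
  · simp [Finset.eq_empty_of_isEmpty]
  · obtain ⟨g, rfl⟩ := (Function.factorsThrough_iff u).1 h
    rw [← Finset.image_image]
    exact Finset.card_image_le

theorem reduction_apply {k : ℕ} (w : Fin k → ℕ) (i : Fin k) :
    reduction w i = ((Finset.univ.filter fun j => w j < w i).image w).card := by
  rw [reduction, Finset.filter_image]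

theorem reduction_lt_reduction_iff {k : ℕ} {w : Fin k → ℕ} {i j : Fin k} :
    reduction w i < reduction w j ↔ w i < w j := by
  have mono : Monotone fun x => ((Finset.univ.image w).filter (· < x)).card := fun x y hxy =>
    Finset.card_le_card <| Finset.monotone_filter_right _ fun _ _ hv => lt_of_lt_of_le hv hxy
  refine ⟨fun h => lt_of_not_ge fun hji => (mono hji).not_gt h, fun h => ?_⟩
  refine Finset.card_lt_card (Finset.ssubset_iff_of_subset ?_ |>.2 ⟨w i, by simp [h], by simp⟩)
  exact Finset.monotone_filter_right _ fun _ _ hv => lt_trans hv h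

theorem reduction_eq_reduction_iff {k : ℕ} {u w : Fin k → ℕ} :
    reduction u = reduction w ↔ ∀ i j, u i < u j ↔ w i < w j := by
  refine ⟨fun h i j => ?_, fun h => funext fun i => ?_⟩
  · rw [← reduction_lt_reduction_iff, h, reduction_lt_reduction_iff]
  · have heq : ∀ i j, u i = u j ↔ w i = w j := fun i j => by
      have := h i j
      have := h j i
      omega
    simp only [reduction_apply, h]
    exact le_antisymm (card_image_le_of_factorsThrough _ fun i j => (heq i j).2)
      (card_image_le_of_factorsThrough _ fun i j => (heq i j).1)

theorem reduction_eq_iff {k : ℕ} {w σ : Fin k → ℕ} (hσ : reduction σ = σ) :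
    reduction w = σ ↔ ∀ i j, w i < w j ↔ σ i < σ j := by
  rw [← reduction_eq_reduction_iff, hσ]

theorem reduction_mem_patterns663A_iff {w : Fin 3 → ℕ} :
    reduction w ∈ patterns663A ↔ w 1 ≠ w 2 ∧ w 0 ≥ w 2 := by
  simp only [patterns663A, Set.mem_insert_iff, Set.mem_singleton_iff,
    reduction_eq_iff (show reduction ![0, 1, 0] = ![0, 1, 0] by decide),
    reduction_eq_iff (show reduction ![1, 0, 1] = ![1, 0, 1] by decide),
    reduction_eq_iff (show reduction ![1, 1, 0] = ![1, 1, 0] by decide),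
    reduction_eq_iff (show reduction ![1, 2, 0] = ![1, 2, 0] by decide),
    reduction_eq_iff (show reduction ![2, 0, 1] = ![2, 0, 1] by decide),
    reduction_eq_iff (show reduction ![2, 1, 0] = ![2, 1, 0] by decide)]
  simp only [Fin.forall_fin_succ, Fin.isValue, Matrix.cons_val_zero, Matrix.cons_val_succ,
    Matrix.cons_val_fin_one, Fin.succ_zero_eq_one, Fin.succ_one_eq_two, IsEmpty.forall_iff,
    not_lt_zero, lt_self_iff_false, iff_false, iff_true, not_lt, and_true, true_and,
    Order.lt_one_iff, Order.lt_two_iff, Nat.not_ofNat_le_one, OfNat.ofNat_ne_zero, one_ne_zero,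
    le_refl, zero_le]
  omega

theorem class663A_eq_patternAvoiders (n : ℕ) :
    class663A n = patternAvoiders patterns663A n := by
  ext a
  refine and_congr_right fun _ => ⟨?_, ?_⟩
  · rintro h σ hσ ⟨p, hp, rfl⟩
    exact h ⟨p 0, p 1, p 2, hp (by decide), hp (by decide), trivial,
      reduction_mem_patterns663A_iff.1 hσ⟩
  · rintro h ⟨i, j, k, hij, hjk, -, hne, hge⟩
    exact h _ (reduction_mem_patterns663A_iff.2 ⟨hne, hge⟩)
      ⟨![i, j, k], by simp [hij, hjk], rfl⟩

/-! ### Appending an entry -/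

/-- `v` is a site of `a` if appending the entry `v` to `a` creates no triple of entries related by
`ρ₁`, `ρ₂`, `ρ₃`. The bound on the entries of an inversion sequence is not part of the notion. -/
def IsSite (ρ₁ ρ₂ ρ₃ : ℕ → ℕ → Prop) {m : ℕ} (a : Fin m → ℕ) (v : ℕ) : Prop :=
  ∀ i j : Fin m, i < j → ρ₁ (a i) (a j) → ρ₂ (a j) v → ¬ ρ₃ (a i) v

section Sites

variable {ρ₁ ρ₂ ρ₃ : ℕ → ℕ → Prop} {m : ℕ}

theorem isSite_snoc_iff (a : Fin m → ℕ) (u v : ℕ) :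
    IsSite ρ₁ ρ₂ ρ₃ (Fin.snoc a u : Fin (m + 1) → ℕ) v ↔
      IsSite ρ₁ ρ₂ ρ₃ a v ∧ ∀ i, ρ₁ (a i) u → ρ₂ u v → ¬ ρ₃ (a i) v := by
  simp only [IsSite, Fin.forall_fin_succ', Fin.snoc_castSucc, Fin.snoc_last,
    Fin.castSucc_lt_castSucc_iff, Fin.castSucc_lt_last, (Fin.le_last _).not_gt,
    false_imp_iff, forall_const, implies_true, and_true, forall_and]

theorem snoc_mem_relationAvoiders_iff (a : Fin m → ℕ) (v : ℕ) :
    (Fin.snoc a v : Fin (m + 1) → ℕ) ∈ relationAvoiders ρ₁ ρ₂ ρ₃ (m + 1) ↔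
      a ∈ relationAvoiders ρ₁ ρ₂ ρ₃ m ∧ v < m + 1 ∧ IsSite ρ₁ ρ₂ ρ₃ a v := by
  simp only [relationAvoiders, inversionSequences, Set.mem_ofPred_eq, Fin.forall_fin_succ',
    Fin.snoc_castSucc, Fin.snoc_last, Fin.val_castSucc, Fin.val_last, not_exists, not_and, IsSite,
    Fin.castSucc_lt_castSucc_iff, Fin.castSucc_lt_last, (Fin.le_last _).not_gt, false_imp_iff,
    forall_const, and_true, forall_and]
  tauto

theorem relationAvoiders_finite (ρ₁ ρ₂ ρ₃ : ℕ → ℕ → Prop) (n : ℕ) :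
    (relationAvoiders ρ₁ ρ₂ ρ₃ n).Finite :=
  (inversionSequences_finite n).subset fun _ h => h.1

open Classical in
theorem sum_relationAvoiders_succ {M : Type*} [AddCommMonoid M] (g : (Fin (m + 1) → ℕ) → M) :
    ∑ b ∈ (relationAvoiders_finite ρ₁ ρ₂ ρ₃ (m + 1)).toFinset, g b =
      ∑ a ∈ (relationAvoiders_finite ρ₁ ρ₂ ρ₃ m).toFinset,
        ∑ v ∈ (Finset.range (m + 1)).filter (IsSite ρ₁ ρ₂ ρ₃ a), g (Fin.snoc a v) := by
  rw [Finset.sum_sigma']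
  refine Finset.sum_bij' (fun b _ => ⟨Fin.init b, b (Fin.last m)⟩) (fun x _ => Fin.snoc x.1 x.2)
    (fun b hb => ?_) (fun x hx => ?_) (fun b _ => ?_) (fun x _ => ?_) (fun b _ => ?_)
  · rw [Set.Finite.mem_toFinset, ← Fin.snoc_init_self b, snoc_mem_relationAvoiders_iff] at hb
    simpa using hb
  · rw [Set.Finite.mem_toFinset, snoc_mem_relationAvoiders_iff]
    simpa using hx
  · exact Fin.snoc_init_self b
  · simp
  · exact congrArg g (Fin.snoc_init_self b).symm

end Sites

/-! ### The generating tree -/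

/-- The least number exceeding all entries of `a`. -/
def strictBound {m : ℕ} (a : Fin m → ℕ) : ℕ :=
  Finset.univ.sup fun i => a i + 1

/-- The sites of `a`, for the relations `-, ≠, ≥`. -/
def IsSite663A {m : ℕ} (a : Fin m → ℕ) (v : ℕ) : Prop :=
  IsSite noRestriction (fun x y => x ≠ y) (fun x y => x ≥ y) a v

open Classical in
/-- The sites of `a` that do not exceed all its entries. -/
noncomputable def lowSites {m : ℕ} (a : Fin m → ℕ) : Finset ℕ :=
  (Finset.range (strictBound a)).filter (IsSite663A a)

/-- The label of `a` in the generating tree consists of the number of the sites in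
`[strictBound a, m]`, less one, and the number of low sites; `atLabel f a` is the value of `f` at
this label. -/
noncomputable def atLabel {M : Type*} (f : ℕ → ℕ → M) {m : ℕ} (a : Fin m → ℕ) : M :=
  f (m - strictBound a) (lowSites a).card

open Finset.HasAntidiagonal in
/-- The sum of `f` over the children of the label `(p, k)` in the generating tree: these are `k`
copies of `(p + 1, 1)` together with `(p, 1), (p - 1, 2), …, (0, p + 1)`. -/
def succession {M : Type*} [AddCommMonoid M] (f : ℕ → ℕ → M) (p k : ℕ) : M :=
  k • f (p + 1) 1 + ∑ ij ∈ antidiagonal p, f ij.2 (ij.1 + 1)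

section Tree

variable {m : ℕ} {a : Fin m → ℕ} {u v : ℕ}

theorem strictBound_le_iff : strictBound a ≤ v ↔ ∀ i, a i < v := by
  simp [strictBound]

theorem strictBound_le_length (ha : a ∈ inversionSequences m) : strictBound a ≤ m :=
  strictBound_le_iff.2 fun i => (ha i).trans_le i.isLt

theorem strictBound_snoc (a : Fin m → ℕ) (u : ℕ) :
    strictBound (Fin.snoc a u : Fin (m + 1) → ℕ) = max (strictBound a) (u + 1) := by
  refine eq_of_forall_ge_iff fun v => ?_
  rw [strictBound_le_iff, Fin.forall_fin_succ', max_le_iff, strictBound_le_iff]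
  simp

theorem mem_lowSites_iff : v ∈ lowSites a ↔ v < strictBound a ∧ IsSite663A a v := by
  simp [lowSites]

theorem isSite663A_of_strictBound_le (hv : strictBound a ≤ v) : IsSite663A a v :=
  fun i _ _ _ _ => (strictBound_le_iff.1 hv i).not_ge

theorem isSite663A_snoc_iff :
    IsSite663A (Fin.snoc a u : Fin (m + 1) → ℕ) v ↔
      IsSite663A a v ∧ (v = u ∨ strictBound a ≤ v) := by
  rw [IsSite663A, isSite_snoc_iff, strictBound_le_iff]
  refine and_congr_right fun _ => ?_
  simp only [noRestriction, forall_const, ge_iff_le, not_le, ne_comm (a := u), or_iff_not_imp_left]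
  exact forall_comm

theorem lowSites_snoc_of_mem (hu : u ∈ lowSites a) :
    lowSites (Fin.snoc a u : Fin (m + 1) → ℕ) = {u} := by
  rw [mem_lowSites_iff] at hu
  ext v
  simp only [mem_lowSites_iff, Finset.mem_singleton, strictBound_snoc,
    isSite663A_snoc_iff, max_eq_left (Nat.succ_le_of_lt hu.1)]
  refine ⟨fun h => h.2.2.resolve_right h.1.not_ge, ?_⟩
  rintro rfl
  exact ⟨hu.1, hu.2, Or.inl rfl⟩

theorem lowSites_snoc_of_strictBound_le (hu : strictBound a ≤ u) :
    lowSites (Fin.snoc a u : Fin (m + 1) → ℕ) = Finset.Ico (strictBound a) (u + 1) := by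
  ext v
  simp only [mem_lowSites_iff, Finset.mem_Ico, strictBound_snoc, isSite663A_snoc_iff,
    max_eq_right (hu.trans u.le_succ)]
  constructor
  · rintro ⟨hv, -, rfl | hv'⟩
    exacts [⟨hu, hv⟩, ⟨hv', hv⟩]
  · exact fun ⟨hv', hv⟩ => ⟨hv, isSite663A_of_strictBound_le hv', Or.inr hv'⟩

theorem disjoint_lowSites_Ico (n : ℕ) :
    Disjoint (lowSites a) (Finset.Ico (strictBound a) n) :=
  Finset.disjoint_left.2 fun _ hv hv' =>
    (mem_lowSites_iff.1 hv).1.not_ge (Finset.mem_Ico.1 hv').1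

open Classical in
theorem filter_range_isSite663A {n : ℕ} (h : strictBound a ≤ n) :
    (Finset.range n).filter (IsSite663A a) = lowSites a ∪ Finset.Ico (strictBound a) n := by
  ext v
  have := isSite663A_of_strictBound_le (a := a) (v := v)
  simp only [mem_lowSites_iff, Finset.mem_filter, Finset.mem_range, Finset.mem_union,
    Finset.mem_Ico]
  grind

variable {M : Type*}

theorem atLabel_snoc_of_mem (f : ℕ → ℕ → M) (ha : strictBound a ≤ m) (hu : u ∈ lowSites a) :
    atLabel f (Fin.snoc a u : Fin (m + 1) → ℕ) = f (m - strictBound a + 1) 1 := by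
  have hlt : u < strictBound a := (mem_lowSites_iff.1 hu).1
  rw [atLabel, lowSites_snoc_of_mem hu, Finset.card_singleton, strictBound_snoc,
    max_eq_left (Nat.succ_le_of_lt hlt), Nat.sub_add_comm ha]

theorem atLabel_snoc_strictBound_add (f : ℕ → ℕ → M) (j : ℕ) :
    atLabel f (Fin.snoc a (strictBound a + j) : Fin (m + 1) → ℕ) =
      f (m - strictBound a - j) (j + 1) := by
  rw [atLabel, lowSites_snoc_of_strictBound_le le_self_add, Nat.card_Ico, strictBound_snoc,
    max_eq_right (by omega)]
  congr 1 <;> omega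

variable [AddCommMonoid M]

open Classical in
theorem sum_atLabel_snoc (f : ℕ → ℕ → M) (ha : strictBound a ≤ m) :
    ∑ v ∈ (Finset.range (m + 1)).filter (IsSite663A a),
      atLabel f (Fin.snoc a v : Fin (m + 1) → ℕ) = atLabel (succession f) a := by
  have hlow : ∑ u ∈ lowSites a, atLabel f (Fin.snoc a u : Fin (m + 1) → ℕ) =
      (lowSites a).card • f (m - strictBound a + 1) 1 :=
    Finset.sum_eq_card_nsmul fun u hu => atLabel_snoc_of_mem f ha hu
  rw [filter_range_isSite663A (ha.trans m.le_succ), Finset.sum_union (disjoint_lowSites_Ico _),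
    hlow, Finset.sum_Ico_eq_sum_range,
    Finset.sum_congr rfl fun j _ => atLabel_snoc_strictBound_add f j, Nat.succ_sub ha,
    atLabel, succession, Finset.Nat.sum_antidiagonal_eq_sum_range_succ_mk]

theorem class663A_finite (n : ℕ) : (class663A n).Finite :=
  relationAvoiders_finite ..

theorem sum_atLabel_class663A (f : ℕ → ℕ → M) (n : ℕ) :
    ∑ a ∈ (class663A_finite n).toFinset, atLabel f a = succession^[n] f 0 0 := by
  classical
  induction n generalizing f with
  | zero =>
    have hempty : (class663A_finite 0).toFinset = {Fin.elim0} :=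
      Finset.eq_singleton_iff_unique_mem.2
        ⟨(class663A_finite 0).mem_toFinset.2 ⟨fun i => i.elim0, fun ⟨i, _⟩ => i.elim0⟩,
          fun a _ => Subsingleton.elim _ _⟩
    rw [hempty, Finset.sum_singleton]
    simp [atLabel, lowSites, strictBound]
  | succ n ih =>
    rw [Function.iterate_succ_apply, ← ih]
    refine (sum_relationAvoiders_succ _).trans (Finset.sum_congr rfl fun a ha => ?_)
    exact sum_atLabel_snoc f <| strictBound_le_length ((class663A_finite n).mem_toFinset.1 ha).1

theorem natCast_ncard_class663A (R : Type*) [AddCommMonoidWithOne R] (n : ℕ) :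
    ((class663A n).ncard : R) = succession^[n] (fun _ _ => 1) 0 0 := by
  rw [← sum_atLabel_class663A, Set.ncard_eq_toFinset_card _ (class663A_finite n)]
  simp [atLabel]

theorem ncard_class663A_initial (n : Fin 9) :
    (class663A n).ncard = (![1, 1, 2, 5, 15, 50, 178, 663, 2552] : Fin 9 → ℕ) n := by
  rw [← Nat.cast_id (class663A n).ncard, natCast_ncard_class663A]
  revert n
  decide +kernel

end Tree

theorem map_succession {M N : Type*} [AddCommMonoid M] [AddCommMonoid N] (φ : M →+ N)
    (f : ℕ → ℕ → M) (p k : ℕ) :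
    φ (succession f p k) = succession (fun p k => φ (f p k)) p k := by
  simp [succession]

section GeneratingFunction

open PowerSeries

theorem coeff_eq_iterate_succession {R : Type*} [Semiring R] {F : ℕ → ℕ → PowerSeries R}
    (hF : ∀ p k, F p k = 1 + X * succession F p k) (n p k : ℕ) :
    coeff n (F p k) = succession^[n] (fun _ _ => 1) p k := by
  induction n generalizing p k with
  | zero => simp [hF p k]
  | succ n ih =>
    rw [hF, map_add, coeff_succ_X_mul, coeff_one, if_neg n.succ_ne_zero, zero_add,
      Function.iterate_succ_apply']
    exact (map_succession (coeff n).toAddMonoidHom F p k).trans (by simp [ih])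

theorem genFun663A_eq_of_eq_one_add_X_mul_succession {R : Type*} [Semiring R]
    {F : ℕ → ℕ → PowerSeries R} (hF : ∀ p k, F p k = 1 + X * succession F p k) :
    genFun663A R = F 0 0 := by
  ext n
  rw [genFun663A, coeff_mk, natCast_ncard_class663A, coeff_eq_iterate_succession hF]

end GeneratingFunction

/-! ### Solving the functional equation -/

/-- The solution of the second-order recurrence with characteristic polynomial
`s² - (2 t - z t²) s + t` and initial values `1` and `t`. For a root `t` of the kernel, this is the
quotient of the characteristic polynomial `z s³ - (1 + z - z²) s² + 2 s - 1` of the succession rule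
by the factor `z s - 1 / t`. -/
def kernelSeq {S : Type*} [CommRing S] (z t : S) : ℕ → S
  | 0 => 1
  | 1 => t
  | p + 2 => (2 * t - z * t ^ 2) * kernelSeq z t (p + 1) - t * kernelSeq z t p

section KernelSeq

open Finset Finset.HasAntidiagonal

variable {S : Type*} [CommRing S] {z t : S}

theorem kernelSeq_recurrence
    (ht : 1 - t - z * t + 2 * z * t ^ 2 + z ^ 2 * t - z ^ 2 * t ^ 3 = 0) (p : ℕ) :
    z * kernelSeq z t (p + 3) - (1 + z - z ^ 2) * kernelSeq z t (p + 2) +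
      2 * kernelSeq z t (p + 1) - kernelSeq z t p = 0 := by
  simp only [kernelSeq]
  linear_combination ((2 - z * t) * kernelSeq z t (p + 1) - kernelSeq z t p) * ht

theorem kernelSeq_succ_sub
    (ht : 1 - t - z * t + 2 * z * t ^ 2 + z ^ 2 * t - z ^ 2 * t ^ 3 = 0) (p : ℕ) :
    kernelSeq z t (p + 1) - kernelSeq z t p =
      z * kernelSeq z t (p + 2) + z ^ 2 * ∑ ij ∈ antidiagonal p, kernelSeq z t (ij.2 + 1) := by
  induction p with
  | zero =>
    simp only [kernelSeq, antidiagonal_zero, sum_singleton]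
    linear_combination -ht
  | succ p ih =>
    rw [Nat.sum_antidiagonal_succ]
    linear_combination ih - kernelSeq_recurrence ht p

theorem kernelSeq_eq_one_sub_add
    (ht : 1 - t - z * t + 2 * z * t ^ 2 + z ^ 2 * t - z ^ 2 * t ^ 3 = 0) (p : ℕ) :
    kernelSeq z t p = 1 - z * t - z + z * kernelSeq z t (p + 1) +
      z * ∑ ij ∈ antidiagonal p, (kernelSeq z t ij.2 + ij.1 * z * kernelSeq z t (ij.2 + 1)) := by
  induction p with
  | zero =>
    simp only [kernelSeq, antidiagonal_zero, sum_singleton, Nat.cast_zero]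
    ring
  | succ p ih =>
    have hsplit : ∑ ij ∈ antidiagonal p,
          (kernelSeq z t ij.2 + (ij.1 + 1 : ℕ) * z * kernelSeq z t (ij.2 + 1)) =
        ∑ ij ∈ antidiagonal p, (kernelSeq z t ij.2 + ij.1 * z * kernelSeq z t (ij.2 + 1)) +
          z * ∑ ij ∈ antidiagonal p, kernelSeq z t (ij.2 + 1) := by
      rw [mul_sum, ← sum_add_distrib]
      exact sum_congr rfl fun ij _ => by push_cast; ring
    rw [Nat.sum_antidiagonal_succ, hsplit]
    push_cast
    linear_combination ih + kernelSeq_succ_sub ht p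

end KernelSeq

/-! ### The kernel equation -/

theorem existsUnique_isFixedPt_of_isAdicComplete {R M : Type*} [CommRing R] (I : Ideal R)
    [AddCommGroup M] [Module R M] [IsAdicComplete I M] {f : M → M}
    (hf : ∀ (n : ℕ) (x y : M), x ≡ y [SMOD (I ^ n • ⊤ : Submodule R M)] →
      f x ≡ f y [SMOD (I ^ (n + 1) • ⊤ : Submodule R M)]) :
    ∃! x, Function.IsFixedPt f x := by
  have smodEq_zero (x y : M) : x ≡ y [SMOD (I ^ 0 • ⊤ : Submodule R M)] := by simp
  have cauchy {m n : ℕ} (hmn : m ≤ n) :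
      f^[m] 0 ≡ f^[n] 0 [SMOD (I ^ m • ⊤ : Submodule R M)] := by
    induction m generalizing n with
    | zero => exact smodEq_zero _ _
    | succ m ih =>
      obtain ⟨n, rfl⟩ := Nat.exists_eq_add_of_le' (Nat.one_le_of_lt hmn)
      simpa only [Function.iterate_succ_apply'] using hf m _ _ (ih (Nat.le_of_succ_le_succ hmn))
  obtain ⟨x, hx⟩ := IsPrecomplete.prec' (I := I) (fun n => f^[n] 0) cauchy
  have hfix : f x = x := (IsHausdorff.eq_iff_smodEq (I := I)).2 fun n => by
    cases n with
    | zero => exact smodEq_zero _ _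
    | succ n =>
      refine (hf n _ _ (hx n)).symm.trans ?_
      rw [← Function.iterate_succ_apply' f n]
      exact hx (n + 1)
  refine ⟨x, hfix, fun y hy => (IsHausdorff.eq_iff_smodEq (I := I)).2 fun n => ?_⟩
  induction n with
  | zero => exact smodEq_zero _ _
  | succ n ih => simpa only [hfix, hy.eq] using hf n _ _ ih

section

open PowerSeries

variable {R : Type*} [CommRing R]

theorem existsUnique_add_X_mul_eval_eq (a : R⟦X⟧) (p : Polynomial R⟦X⟧) :
    ∃! x : R⟦X⟧, a + X * p.eval x = x := by
  refine existsUnique_isFixedPt_of_isAdicComplete (Ideal.span {(X : R⟦X⟧)}) fun n x y hxy => ?_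
  rw [SModEq.sub_mem, smul_eq_mul, Ideal.mul_top, Ideal.span_singleton_pow,
    Ideal.mem_span_singleton] at hxy ⊢
  rw [add_sub_add_left_eq_sub, ← mul_sub, pow_succ']
  exact mul_dvd_mul_left X (hxy.trans (Polynomial.sub_dvd_eval_sub x y p))

theorem existsUnique_kernel663A_eq_zero (R : Type*) [CommRing R] :
    ∃! x : R⟦X⟧, kernel663A x = 0 := by
  refine (existsUnique_congr fun x => ?_).1 (existsUnique_add_X_mul_eval_eq 1
    (Polynomial.C (X - 1) * Polynomial.X + 2 * Polynomial.X ^ 2 -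
      Polynomial.C X * Polynomial.X ^ 3))
  rw [← sub_eq_zero]
  refine Eq.congr_left ?_
  simp only [kernel663A, Polynomial.eval_sub, Polynomial.eval_add, Polynomial.eval_mul,
    Polynomial.eval_C, Polynomial.eval_X, Polynomial.eval_pow, Polynomial.eval_ofNat]
  ring

theorem isUnit_one_sub_X_mul_sub_X (t : R⟦X⟧) : IsUnit (1 - X * t - X) := by
  simp [isUnit_iff_constantCoeff]

variable {t : R⟦X⟧}

theorem genFun663A_mul_one_sub_X_mul_sub_X (ht : kernel663A t = 0) :
    genFun663A R * (1 - X * t - X) = 1 - X * t := by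
  obtain ⟨d, hd⟩ := (isUnit_one_sub_X_mul_sub_X t).exists_left_inv
  let F (p k : ℕ) : R⟦X⟧ := d * (kernelSeq X t p + ((k : R⟦X⟧) - 1) * X * kernelSeq X t (p + 1))
  have hF (p k : ℕ) : F p k = 1 + X * succession F p k := by
    have hsum : ∑ ij ∈ Finset.HasAntidiagonal.antidiagonal p, F ij.2 (ij.1 + 1) =
        d * ∑ ij ∈ Finset.HasAntidiagonal.antidiagonal p,
          (kernelSeq X t ij.2 + (ij.1 : R⟦X⟧) * X * kernelSeq X t (ij.2 + 1)) := by
      simp only [F, Nat.cast_add, Nat.cast_one, add_sub_cancel_right, Finset.mul_sum]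
    rw [succession, hsum, nsmul_eq_mul]
    simp only [F, Nat.cast_one, sub_self, zero_mul, add_zero]
    linear_combination d * kernelSeq_eq_one_sub_add ht p + hd
  rw [genFun663A_eq_of_eq_one_add_X_mul_succession hF]
  simp only [F, kernelSeq, Nat.cast_zero]
  linear_combination (1 - X * t) * hd

theorem genFun663A_mul_X_mul (ht : kernel663A t = 0) :
    genFun663A R * (X * t) = (t - 1) * (1 - X * t + X ^ 2 * t) := by
  refine (isUnit_one_sub_X_mul_sub_X t).mul_right_cancel ?_
  have hA := genFun663A_mul_one_sub_X_mul_sub_X ht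
  simp only [kernel663A] at ht
  linear_combination X * t * hA + ((1 - X * t) * t - (t - 1) * (1 - X * t - X)) * ht

theorem ne_zero_of_kernel663A_eq_zero [Nontrivial R] (ht : kernel663A t = 0) : t ≠ 0 := by
  rintro rfl
  simp [kernel663A] at ht

theorem genFunLaurent663A_eq_div {K : Type*} [Field K] {x : K⟦X⟧} (hx : kernel663A x = 0) :
    genFunLaurent663A K =
      (((x - 1) * (1 - X * x + X ^ 2 * x) : K⟦X⟧) : LaurentSeries K) /
        ((X * x : K⟦X⟧) : LaurentSeries K) := by
  have hne : ((X * x : K⟦X⟧) : LaurentSeries K) ≠ 0 :=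
    (map_ne_zero_iff _ HahnSeries.ofPowerSeries_injective).2
      (mul_ne_zero X_ne_zero (ne_zero_of_kernel663A_eq_zero hx))
  rw [eq_div_iff hne, genFunLaurent663A, ← genFun663A_mul_X_mul hx]
  exact (map_mul _ _ _).symm

theorem coeff_genFun663A_initial (R : Type*) [Semiring R] (n : Fin 9) :
    coeff (n : ℕ) (genFun663A R) = (![1, 1, 2, 5, 15, 50, 178, 663, 2552] : Fin 9 → R) n := by
  rw [genFun663A, coeff_mk, ncard_class663A_initial]
  fin_cases n <;> simp

theorem genFun663A_cubic :
    genFun663A R ^ 3 - 2 * (2 - X) * genFun663A R ^ 2 + (4 - X) * genFun663A R - 1 = 0 := by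
  obtain ⟨t, ht, -⟩ := existsUnique_kernel663A_eq_zero R
  have hA := genFun663A_mul_one_sub_X_mul_sub_X ht
  simp only [kernel663A] at ht
  refine ((isUnit_one_sub_X_mul_sub_X t).pow 3).mul_left_eq_zero.1 ?_
  set D := 1 - X * t - X with hD
  set A := genFun663A R
  calc (A ^ 3 - 2 * (2 - X) * A ^ 2 + (4 - X) * A - 1) * D ^ 3
      = (A * D) ^ 3 - 2 * (2 - X) * (A * D) ^ 2 * D + (4 - X) * (A * D) * D ^ 2 - D ^ 3 := by ring
    _ = X ^ 2 * (1 - t - X * t + 2 * X * t ^ 2 + X ^ 2 * t - X ^ 2 * t ^ 3) := by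
      rw [hA, hD]
      ring
    _ = 0 := by rw [ht, mul_zero]

end

/-! ### The minimal polynomial -/

section

open Polynomial

/-- The monic cubic `T³ - 2 (2 - z) T² + (4 - z) T - 1` over the polynomial ring in `z`. -/
noncomputable def monicCubic663A (R : Type*) [CommRing R] : R[X][X] :=
  X ^ 3 - C (2 * (2 - X)) * X ^ 2 + C (4 - X) * X - 1

theorem monicCubic663A_natDegree (R : Type*) [CommRing R] [Nontrivial R] :
    (monicCubic663A R).natDegree = 3 := by
  unfold monicCubic663A
  compute_degree!

theorem monicCubic663A_monic (R : Type*) [CommRing R] : (monicCubic663A R).Monic := by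
  nontriviality R
  unfold monicCubic663A
  monicity!

theorem aeval_genFun663A_monicCubic663A (R : Type*) [CommRing R] :
    aeval (genFun663A R) (monicCubic663A R) = 0 := by
  rw [← genFun663A_cubic (R := R)]
  have h2 : ((2 : R[X]) : PowerSeries R) = 2 := map_ofNat coeToPowerSeries.ringHom 2
  have h4 : ((4 : R[X]) : PowerSeries R) = 4 := map_ofNat coeToPowerSeries.ringHom 4
  simp [monicCubic663A, PowerSeries.algebraMap_apply', h2, h4]

section IsDomain

variable (R : Type*) [CommRing R] [IsDomain R]

theorem monicCubic663A_not_isRoot (p : R[X]) : ¬ (monicCubic663A R).IsRoot p := by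
  intro hp
  simp only [monicCubic663A, IsRoot.def, eval_sub, eval_add, eval_mul, eval_pow, eval_C, eval_X,
    eval_one] at hp
  have hunit : IsUnit p := IsUnit.of_mul_eq_one (p ^ 2 - 2 * (2 - X) * p + (4 - X))
    (by linear_combination hp)
  obtain ⟨c, hc, rfl⟩ := Polynomial.isUnit_iff.1 hunit
  have h0 := congrArg (eval 0) hp
  have h1 := congrArg (eval 1) hp
  simp only [eval_sub, eval_add, eval_mul, eval_pow, eval_C, eval_X, eval_one, eval_zero,
    eval_ofNat] at h0 h1
  have hc2 : 2 * c = 1 := by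
    refine mul_left_cancel₀ hc.ne_zero ?_
    linear_combination h1 - h0
  exact one_ne_zero (α := R) (by linear_combination 8 * h0 - (4 * c ^ 2 - 14 * c + 9) * hc2)

theorem monicCubic663A_irreducible : Irreducible (monicCubic663A R) := by
  have hdeg := monicCubic663A_natDegree R
  rw [(monicCubic663A_monic R).irreducible_iff_roots_eq_zero_of_degree_le_three (by lia)
    (by lia), Multiset.eq_zero_iff_forall_notMem]
  exact fun p hp => monicCubic663A_not_isRoot R p (isRoot_of_mem_roots hp)

end IsDomain

theorem isScalarTower_polynomial_powerSeries_laurentSeries (R : Type*) [CommRing R] :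
    IsScalarTower R[X] (PowerSeries R) (LaurentSeries R) :=
  IsScalarTower.of_algebraMap_eq fun _ => rfl

variable (K : Type*) [Field K]

theorem map_monicCubic663A :
    (monicCubic663A K).map (algebraMap K[X] (RatFunc K)) = -cubic663A K := by
  have h2 : algebraMap K[X] (RatFunc K) 2 = 2 := map_ofNat _ 2
  have h4 : algebraMap K[X] (RatFunc K) 4 = 4 := map_ofNat _ 4
  simp only [monicCubic663A, cubic663A, Polynomial.map_sub, Polynomial.map_add, Polynomial.map_mul,
    Polynomial.map_pow, Polynomial.map_one, map_X, map_C, map_sub, map_mul, RatFunc.algebraMap_X,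
    h2, h4]
  ring

theorem minpoly_genFunLaurent663A :
    minpoly (RatFunc K) (genFunLaurent663A K) =
      (monicCubic663A K).map (algebraMap K[X] (RatFunc K)) := by
  have hmonic := monicCubic663A_monic K
  refine (minpoly.eq_of_irreducible_of_monic ?_ ?_ (hmonic.map _)).symm
  · exact hmonic.irreducible_iff_irreducible_map_fraction_map.1 (monicCubic663A_irreducible K)
  · rw [aeval_map_algebraMap]
    have := isScalarTower_polynomial_powerSeries_laurentSeries K
    exact (aeval_algebraMap_apply (LaurentSeries K) (genFun663A K) (monicCubic663A K)).trans
      (by rw [aeval_genFun663A_monicCubic663A, map_zero])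

end

theorem mainTheorem4_general (K : Type*) [Field K] :
    (∀ n : ℕ, class663A n = patternAvoiders patterns663A n) ∧
    (∃ x : PowerSeries K,
      (kernel663A x = 0 ∧ ∀ y : PowerSeries K, kernel663A y = 0 → y = x) ∧
      genFunLaurent663A K =
        (((x - 1) * (1 - PowerSeries.X * x + PowerSeries.X ^ 2 * x) : PowerSeries K) :
            LaurentSeries K) /
          ((PowerSeries.X * x : PowerSeries K) : LaurentSeries K)) ∧
    (∀ n : Fin 9, PowerSeries.coeff (n : ℕ) (genFun663A K) =
      (![1, 1, 2, 5, 15, 50, 178, 663, 2552] : Fin 9 → K) n) ∧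
    IsAlgebraic (RatFunc K) (genFunLaurent663A K) ∧
    (minpoly (RatFunc K) (genFunLaurent663A K)).natDegree = 3 ∧
    minpoly (RatFunc K) (genFunLaurent663A K) = -cubic663A K := by
  obtain ⟨x, hx, hunique⟩ := existsUnique_kernel663A_eq_zero K
  have hminpoly := minpoly_genFunLaurent663A K
  have hdegree : (minpoly (RatFunc K) (genFunLaurent663A K)).natDegree = 3 := by
    rw [hminpoly, (monicCubic663A_monic K).natDegree_map, monicCubic663A_natDegree]
  have hintegral : IsIntegral (RatFunc K) (genFunLaurent663A K) :=
    minpoly.ne_zero_iff.1 (Polynomial.ne_zero_of_natDegree_gt (n := 0) (by lia))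
  exact ⟨class663A_eq_patternAvoiders, ⟨x, ⟨hx, hunique⟩, genFunLaurent663A_eq_div hx⟩,
    coeff_genFun663A_initial K, hintegral.isAlgebraic, hdegree,
    hminpoly.trans (map_monicCubic663A K)⟩

theorem mainTheorem4 (K : Type*) [Field K] [CharZero K] :
    -- the triple of relations and the set of patterns define the same class
    (∀ n : ℕ, class663A n = patternAvoiders patterns663A n) ∧
    -- the kernel has exactly one power series root `x`, and the generating function, as a Laurent
    -- series in `z`, is `(x - 1) (1 - z x + z² x) / (z x)`
    (∃ x : PowerSeries K,
      (kernel663A x = 0 ∧ ∀ y : PowerSeries K, kernel663A y = 0 → y = x) ∧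
      genFunLaurent663A K =
        (((x - 1) * (1 - PowerSeries.X * x + PowerSeries.X ^ 2 * x) : PowerSeries K) :
            LaurentSeries K) /
          ((PowerSeries.X * x : PowerSeries K) : LaurentSeries K)) ∧
    -- the first terms
    (∀ n : Fin 9, PowerSeries.coeff (n : ℕ) (genFun663A K) =
      (![1, 1, 2, 5, 15, 50, 178, 663, 2552] : Fin 9 → K) n) ∧
    -- algebraic of degree 3; the minimal polynomial is the given cubic, made monic by a sign
    IsAlgebraic (RatFunc K) (genFunLaurent663A K) ∧
    (minpoly (RatFunc K) (genFunLaurent663A K)).natDegree = 3 ∧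
    minpoly (RatFunc K) (genFunLaurent663A K) = -cubic663A K :=
  mainTheorem4_general K
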